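/- Let $d\ge 2$ and let $\Lambda=\prod_{i=1}^d[a_i,b_i)\subset\mathbb R^d$ ($a_i<b_i$) be a rectangular box with periodic boundary conditions: for $x,y\in\Lambda$ let $|x-y|$ denote the Euclidean length of the difference modulo $\Lambda$, i.e. $|x-y|=\min_{k\in\mathbb Z^d}\|x-y+(k_i(b_i-a_i))_i\|_2$. Let $\mathcal X_\Lambda$ be the set of all finite subsets of $\Lambda$, and let $L_\Lambda$ be the Lebesgue–Poisson measure on $\mathcal X_\Lambda$, $$L_\Lambda(A)=\sum_{n\ge0}\frac1{n!}\int_{\Lambda^n}1_A(\{x_1,\dots,x_n\})\,dx_1\cdots dx_n .$$ For $X\in\mathcal X_\Lambda$, join two distinct points $x,y\in X$ by an edge if and only if $|x-y|\le1$. The clusters of $X$ are the (vertex sets of the) connected components of this graph, and $k(X)$ is their number. For real $q>0$ and $z>0$ let $\chi_{\Lambda,z,0}$ be the random-cluster measure of the continuum Potts (Widom–Rowlinson) model at temperature $T=0$, i.e. the probability measure on $\mathcal X_\Lambda$ $$\chi_{\Lambda,z,0}(dX)=Z_{\Lambda,z,0}^{-1}\,z^{\#X}q^{k(X)}\,L_\Lambda(dX),$$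 where $Z_{\Lambda,z,0}$ is the normalizing constant. For a cluster $C$ of $X$ let $\Delta_C(X)=\{x\in\Lambda:\ |y-x|>1\text{ for all }y\in X\setminus C\}$ be its free space. For $0<\gamma<1$, the cluster $C$ is called $\gamma$-confined if $\#C\ge2$ and there are no two Borel sets $\Delta_1,\Delta_2\subset\Delta_C(X)$ with $\operatorname{dist}(\Delta_1,\Delta_2)>1$ (distance modulo $\Lambda$) and with Lebesgue measures $|\Delta_1|,|\Delta_2|\ge\frac\gamma2|\Delta_C(X)|$. Let $0<\gamma<1$, $N_0\in\mathbb N$ and $\varepsilon>0$. Then there exists $q_0\ge1$ (depending only on $\Lambda,\gamma,N_0,\varepsilon$) such that for all real $q\ge q_0$ and all $z>0$ $$\chi_{\Lambda,z,0}\big(A^{\rm dis}_\Lambda\cup A^{\rm ord}_\Lambda\big)\ge1-\varepsilon,$$ where $$A^{\rm ord}_\Lambda=\{X\in\mathcal X_\Lambda:\ \text{some cluster }C\text{ of }X\text{ has }\#C\ge N_0\},$$ $$A^{\rm dis}_\Lambda=\{X\in\mathcal X_\Lambda:\ \text{every cluster }C\text{ of }X\text{ satisfies }\#C=1\text{ or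 is }\gamma\text{-confined}\}.$$ -/

import Mathlib

open MeasureTheory Set
open scoped ENNReal

noncomputable section

namespace WidomRowlinson

variable {d : ℕ}

/-- The rectangular box `Λ = ∏ᵢ [aᵢ, bᵢ)` in Euclidean space. -/
def box (a b : Fin d → ℝ) : Set (EuclideanSpace ℝ (Fin d)) :=
  {x | ∀ i, x i ∈ Ico (a i) (b i)}

/-- The vector `(kᵢ (bᵢ - aᵢ))ᵢ` of the lattice of periods of the box. -/
def period (a b : Fin d → ℝ) (k : Fin d → ℤ) : EuclideanSpace ℝ (Fin d) :=
  WithLp.toLp 2 fun i => (k i : ℝ) * (b i - a i)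

/-- The length `|x - y|` of the difference of two points of the box, understood modulo the box. -/
def perDist {a b : Fin d → ℝ} (x y : box a b) : ℝ :=
  ⨅ k : Fin d → ℤ, ‖(x : EuclideanSpace ℝ (Fin d)) - y + period a b k‖

theorem perDist_comm {a b : Fin d → ℝ} (x y : box a b) : perDist x y = perDist y x := by
  unfold perDist
  refine (Equiv.neg (Fin d → ℤ)).iInf_congr fun k => ?_
  rw [← norm_neg]
  congr 1
  ext i
  simp [period]
  ring

/-- The distance of two subsets of the box with respect to `perDist`
(equal to `∞` if one of them is empty). -/
def setDist {a b : Fin d → ℝ} (S T : Set (box a b)) : ℝ≥0∞ :=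
  ⨅ x ∈ S, ⨅ y ∈ T, ENNReal.ofReal (perDist x y)

/-- Lebesgue measure on the box. -/
def lebesgue (a b : Fin d → ℝ) : Measure (box a b) :=
  (volume : Measure (EuclideanSpace ℝ (Fin d))).comap Subtype.val

/-- The space of all finite subsets `X` of the box. (It is a structure of its own, because the
σ-algebra below differs from the one that Mathlib puts on `Finset`.) -/
structure Config (a b : Fin d → ℝ) where
  /-- The set of occupied positions. -/
  points : Finset (box a b)

/-- The configuration `{x₁, …, xₙ}`. -/
def ofTuple {a b : Fin d → ℝ} (n : ℕ) (x : Fin n → box a b) : Config a b :=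
  ⟨(Set.finite_range x).toFinset⟩

/-- A set `A` of configurations is measurable if, for every `n`, the set of all `(x₁, …, xₙ) ∈ Λⁿ`
with `{x₁, …, xₙ} ∈ A` is Borel. -/
instance instMeasurableSpaceConfig (a b : Fin d → ℝ) : MeasurableSpace (Config a b) :=
  ⨅ n : ℕ, MeasurableSpace.map (ofTuple n) inferInstance

/-- The Lebesgue-Poisson measure
`L(A) = ∑ₙ (1 / n!) ∫_{Λⁿ} 1_A({x₁, …, xₙ}) dx₁ ⋯ dxₙ`. -/
def lebesguePoisson (a b : Fin d → ℝ) : Measure (Config a b) :=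
  Measure.sum fun n : ℕ =>
    ((n.factorial : ℝ≥0∞)⁻¹) • (Measure.pi fun _ : Fin n => lebesgue a b).map (ofTuple n)

/-- The graph `(X, E_X)`: distinct points of `X` are joined if and only if their distance modulo
the box is at most `1`. -/
def graph {a b : Fin d → ℝ} (X : Finset (box a b)) : SimpleGraph {x // x ∈ X} where
  Adj x y := x ≠ y ∧ perDist x.1 y.1 ≤ 1
  symm := ⟨fun x y h => ⟨h.1.symm, perDist_comm x.1 y.1 ▸ h.2⟩⟩
  loopless := ⟨fun _ h => h.1 rfl⟩

/-- The number `k(X)` of clusters of `(X, E_X)`. -/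
def numClusters {a b : Fin d → ℝ} (X : Finset (box a b)) : ℕ :=
  Nat.card (graph X).ConnectedComponent

/-- `C` is a cluster of `X`, i.e. the set of vertices of a connected component of `(X, E_X)`. -/
def IsCluster {a b : Fin d → ℝ} (X C : Finset (box a b)) : Prop :=
  ∃ c : (graph X).ConnectedComponent, (C : Set (box a b)) = Subtype.val '' c.supp

/-- The density `z ^ #X * q ^ k(X)`. -/
def weight {a b : Fin d → ℝ} (q z : ℝ) (X : Config a b) : ℝ≥0∞ :=
  ENNReal.ofReal (z ^ X.points.card * q ^ numClusters X.points)

/-- The normalizing constant. -/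
def partitionFunction (a b : Fin d → ℝ) (q z : ℝ) : ℝ≥0∞ :=
  ∫⁻ X, weight q z X ∂(lebesguePoisson a b)

/-- The random-cluster measure `Z⁻¹ z ^ #X q ^ k(X) L(dX)` at temperature `0`. At temperature `0`
the edge set of the random graph is the deterministic set `E_X`, so that the measure is a measure
on configurations `X`. -/
def randomCluster (a b : Fin d → ℝ) (q z : ℝ) : Measure (Config a b) :=
  (partitionFunction a b q z)⁻¹ • (lebesguePoisson a b).withDensity (weight q z)

/-- The set of all points of the box that are connected to `X \ C`. -/
def occupied {a b : Fin d → ℝ} (X C : Finset (box a b)) : Set (box a b) :=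
  {x | ∃ y ∈ (X : Set (box a b)) \ C, perDist y x ≤ 1}

/-- The free space available to `C` in the configuration `X`. -/
def freeSpace {a b : Fin d → ℝ} (X C : Finset (box a b)) : Set (box a b) :=
  (occupied X C)ᶜ

/-- The cluster `C` of `X` is `γ`-confined: it has at least two points, and its free space has no
two Borel subsets at distance `> 1` each of which contains a fraction `γ / 2` of the free volume. -/
def IsConfined {a b : Fin d → ℝ} (γ : ℝ) (X C : Finset (box a b)) : Prop :=
  2 ≤ C.card ∧
    ¬ ∃ S T : Set (box a b), MeasurableSet S ∧ MeasurableSet T ∧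
      S ⊆ freeSpace X C ∧ T ⊆ freeSpace X C ∧ 1 < setDist S T ∧
      ENNReal.ofReal (γ / 2) * lebesgue a b (freeSpace X C) ≤ lebesgue a b S ∧
      ENNReal.ofReal (γ / 2) * lebesgue a b (freeSpace X C) ≤ lebesgue a b T

/-- Some cluster has at least `N₀` points. -/
def ordered (a b : Fin d → ℝ) (N₀ : ℕ) : Set (Config a b) :=
  {X | ∃ C, IsCluster X.points C ∧ N₀ ≤ C.card}

/-- Every cluster is a singleton or `γ`-confined. -/
def disordered (a b : Fin d → ℝ) (γ : ℝ) : Set (Config a b) :=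
  {X | ∀ C, IsCluster X.points C → C.card = 1 ∨ IsConfined γ X.points C}

end WidomRowlinson

end

open MeasureTheory Set
open scoped ENNReal

noncomputable section

namespace WidomRowlinson

variable {d : ℕ} {a b : Fin d → ℝ}

/-! If neither event occurs, some cluster `C` with `2 ≤ #C < N₀` is not confined. Fix the remaining
points `Y`, let `D` be the free space they leave, and write `g = γ / 2`, `n = #C`. The
configurations having such a cluster fill at most a volume `|D| ^ n`, with at most `k(Y) + 1`
clusters each. Placing one of the `n` points in `Δ₁` and the others in `Δ₂` instead yields a volume
at least `(g |D|) ^ n` of configurations with at least `k(Y) + 2` clusters. Resampling thus gains a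
factor `q g ^ n ≥ q g ^ N₀`; the number of points is unchanged, so `z` plays no role
(`lintegral_isRemovable_le`).

The resampled set of indices is not known in advance, so one sums over all of them. It is always
separated from the rest, and a configuration has at most `M` separated subsets, with `M` depending
on the box alone (`exists_card_isSeparated_le`). Hence the bad event has probability at most `M / (q
g ^ N₀)`, which is small for large `q`.

The argument runs on indexed families `(x₁, …, xₙ)`, almost surely injective. The bad event is
enlarged to a measurable one, `exceptional`, in which the existence of `Δ₁, Δ₂` is replaced by the
volume inequality `Splits`. -/

theorem perDist_nonneg (x y : box a b) : 0 ≤ perDist x y :=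
  Real.iInf_nonneg fun _ => norm_nonneg _

theorem perDist_le_dist (x y : box a b) : perDist x y ≤ dist x y := by
  have h0 : period a b 0 = 0 := by ext i; simp [period]
  refine (ciInf_le ⟨0, ?_⟩ 0).trans_eq ?_
  · rintro _ ⟨k, rfl⟩
    exact norm_nonneg _
  · rw [h0, add_zero, Subtype.dist_eq, dist_eq_norm]

theorem perDist_self (x : box a b) : perDist x x = 0 :=
  le_antisymm ((perDist_le_dist x x).trans_eq (dist_self x)) (perDist_nonneg x x)

/-! ### Clusters and separated subsets of indexed families of points. -/

section Combinatorics

variable {α β : Type*}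

/-- Two distinct indices are joined if the points they carry have distance at most `1`. -/
def proximityGraph (f : α → box a b) : SimpleGraph α where
  Adj i j := i ≠ j ∧ perDist (f i) (f j) ≤ 1
  symm := ⟨fun i j h => ⟨h.1.symm, perDist_comm (f i) (f j) ▸ h.2⟩⟩
  loopless := ⟨fun _ h => h.1 rfl⟩

/-- The number of clusters of an indexed family of points. -/
def clusterCount (f : α → box a b) : ℕ :=
  Nat.card (proximityGraph f).ConnectedComponent

/-- The points with indices in `A` have distance larger than `1` from all other points. -/
def IsSeparated (f : α → box a b) (A : Set α) : Prop :=
  ∀ i ∈ A, ∀ j ∉ A, 1 < perDist (f i) (f j)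

/-- The family splits into two nonempty parts of distance larger than `1`. -/
def IsDisconnected (f : α → box a b) : Prop :=
  ∃ A : Set α, A.Nonempty ∧ Aᶜ.Nonempty ∧ IsSeparated f A

/-- The part of the box that is not within distance `1` of `Y`. -/
def freeOf (Y : Set (box a b)) : Set (box a b) :=
  {u | ∀ v ∈ Y, 1 < perDist v u}

theorem freeSpace_eq_freeOf (X C : Finset (box a b)) :
    freeSpace X C = freeOf ((X : Set (box a b)) \ C) := by
  ext u
  simp [freeSpace, occupied, freeOf]

theorem reachable_of_perDist_le {f : α → box a b} {i j : α} (h : perDist (f i) (f j) ≤ 1) :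
    (proximityGraph f).Reachable i j := by
  by_cases hij : i = j
  · rw [hij]
  · exact SimpleGraph.Adj.reachable (G := proximityGraph f) ⟨hij, h⟩

theorem eq_of_reachable {f : α → box a b} {φ : α → β}
    (h : ∀ i j, perDist (f i) (f j) ≤ 1 → φ i = φ j) {i j : α}
    (hij : (proximityGraph f).Reachable i j) : φ i = φ j := by
  obtain ⟨w⟩ := hij
  induction w with
  | nil => rfl
  | cons hadj _ ih => exact (h _ _ hadj.2).trans ih

/-- A labelling that agrees on close points is constant on clusters, hence factors through the set
of components. All lower bounds on the number of clusters come from this. -/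
theorem card_le_clusterCount [Finite α] {f : α → box a b} {φ : α → β}
    (h : ∀ i j, perDist (f i) (f j) ≤ 1 → φ i = φ j) (hφ : Function.Surjective φ) :
    Nat.card β ≤ clusterCount f := by
  refine Nat.card_le_card_of_surjective
    (SimpleGraph.ConnectedComponent.lift φ fun v w p _ => eq_of_reachable h p.reachable) fun y => ?_
  obtain ⟨i, rfl⟩ := hφ y
  exact ⟨(proximityGraph f).connectedComponentMk i, rfl⟩

theorem clusterCount_le_card [Finite α] (f : α → box a b) : clusterCount f ≤ Nat.card α :=
  Nat.card_le_card_of_surjective _ (Quot.mk_surjective)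

theorem clusterCount_le_clusterCount_comp [Finite β] (f : α → box a b) (φ : β → α)
    (hφ : Function.Surjective φ) : clusterCount f ≤ clusterCount (f ∘ φ) :=
  card_le_clusterCount
    (φ := fun i => (proximityGraph f).connectedComponentMk (φ i))
    (fun _ _ h => SimpleGraph.ConnectedComponent.sound (reachable_of_perDist_le h))
    (Quot.mk_surjective.comp hφ)

/-- Indices carrying the same point are at distance `0`, hence joined, so repetitions create no new
clusters. -/
theorem clusterCount_comp_of_surjective [Finite β] (f : α → box a b) (φ : β → α)
    (hφ : Function.Surjective φ) : clusterCount (f ∘ φ) = clusterCount f := by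
  have : Finite α := Finite.of_surjective φ hφ
  refine le_antisymm ?_ (clusterCount_le_clusterCount_comp f φ hφ)
  let s := Function.surjInv hφ
  have hs : ∀ i, φ (s i) = i := Function.surjInv_eq hφ
  refine card_le_clusterCount
    (φ := fun i => (proximityGraph (f ∘ φ)).connectedComponentMk (s i)) (fun i j h => ?_) ?_
  · refine SimpleGraph.ConnectedComponent.sound (reachable_of_perDist_le ?_)
    simpa [hs] using h
  · intro c
    induction c using SimpleGraph.ConnectedComponent.ind with
    | h v =>
      refine ⟨φ v, SimpleGraph.ConnectedComponent.sound (reachable_of_perDist_le ?_)⟩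
      simp [hs, perDist_self]

theorem clusterCount_eq_clusterCount_range [Finite α] (f : α → box a b) :
    clusterCount f = clusterCount (Subtype.val : range f → box a b) := by
  rw [← clusterCount_comp_of_surjective _ _ rangeFactorization_surjective]
  rfl

/-- The number of clusters only depends on the set of points. -/
theorem clusterCount_eq_of_range_eq [Finite α] [Finite β] {f : α → box a b} {g : β → box a b}
    (h : range f = range g) : clusterCount f = clusterCount g := by
  rw [clusterCount_eq_clusterCount_range f, clusterCount_eq_clusterCount_range g, h]

/-- Removing a separated disconnected part decreases the number of clusters by at least two. -/
theorem clusterCount_add_two_le [Finite α] {f : α → box a b} {A : Set α} (hA : IsSeparated f A)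
    (hd : IsDisconnected fun i : A => f i) :
    clusterCount (fun i : {i // i ∉ A} => f i) + 2 ≤ clusterCount f := by
  classical
  obtain ⟨B, ⟨i₁, h₁⟩, ⟨i₂, h₂⟩, hB⟩ := hd
  let G := proximityGraph (fun i : {i // i ∉ A} => f i)
  -- The two halves of `A` receive the two extra labels `none` and `some none`; every other index is
  -- labelled by its component outside `A`.
  let φ : α → Option (Option G.ConnectedComponent) := fun i =>
    if h : i ∈ A then (if (⟨i, h⟩ : A) ∈ B then none else some none)
    else some (some (G.connectedComponentMk ⟨i, h⟩))
  have hcard : Nat.card (Option (Option G.ConnectedComponent)) =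
      clusterCount (fun i : {i // i ∉ A} => f i) + 2 := by
    rw [Finite.card_option, Finite.card_option]
    rfl
  rw [← hcard]
  refine card_le_clusterCount (φ := φ) (fun i j hij => ?_) ?_
  · have hsep : ∀ i j, perDist (f i) (f j) ≤ 1 → i ∈ A → j ∈ A := fun i j h hi => by
      by_contra hj
      exact absurd h (hA i hi j hj).not_ge
    have hji : perDist (f j) (f i) ≤ 1 := perDist_comm (f i) (f j) ▸ hij
    by_cases hi : i ∈ A
    · have hj := hsep i j hij hi
      have hiff : (⟨i, hi⟩ : A) ∈ B ↔ (⟨j, hj⟩ : A) ∈ B := by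
        constructor <;> intro h <;> by_contra h'
        · exact absurd hij (hB _ h _ h').not_ge
        · exact absurd hji (hB _ h _ h').not_ge
      simp only [φ, hi, hj, dif_pos, hiff]
    · have hj : j ∉ A := fun hj => hi (hsep j i hji hj)
      simp only [φ, hi, hj, dif_neg, not_false_eq_true]
      congr 2
      exact SimpleGraph.ConnectedComponent.sound
        (reachable_of_perDist_le (f := fun i : {i // i ∉ A} => f i) hij)
  · rintro (_ | _ | c)
    · exact ⟨i₁, by simp [φ, h₁]⟩
    · exact ⟨i₂, by simp [φ, show i₂ ∉ B from h₂]⟩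
    · induction c using SimpleGraph.ConnectedComponent.ind with
      | h v => exact ⟨v, by simp [φ, show (v : α) ∉ A from v.2]⟩

theorem IsDisconnected.comp_equiv {f : α → box a b} (h : IsDisconnected f) (e : β ≃ α) :
    IsDisconnected (f ∘ e) := by
  obtain ⟨A, ⟨i, hi⟩, ⟨j, hj⟩, hA⟩ := h
  exact ⟨e ⁻¹' A, ⟨e.symm i, by simpa using hi⟩, ⟨e.symm j, by simpa using hj⟩,
    fun i hi j hj => hA _ hi _ hj⟩

theorem isDisconnected_comp_equiv_iff {f : α → box a b} (e : β ≃ α) :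
    IsDisconnected (f ∘ e) ↔ IsDisconnected f :=
  ⟨fun h => by simpa [Function.comp_assoc] using h.comp_equiv e.symm, fun h => h.comp_equiv e⟩

theorem isCluster_subset {X C : Finset (box a b)} (h : IsCluster X C) : C ⊆ X := by
  obtain ⟨c, hc⟩ := h
  intro u hu
  have : u ∈ (C : Set (box a b)) := hu
  rw [hc] at this
  obtain ⟨v, -, rfl⟩ := this
  exact v.2

theorem isCluster_nonempty {X C : Finset (box a b)} (h : IsCluster X C) : C.Nonempty := by
  obtain ⟨c, hc⟩ := h
  rw [← Finset.coe_nonempty, hc]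
  exact c.nonempty_supp.image _

theorem isCluster_one_lt_perDist {X C : Finset (box a b)} (h : IsCluster X C) {u v : box a b}
    (hu : u ∈ C) (hv : v ∈ X) (hvC : v ∉ C) : 1 < perDist u v := by
  obtain ⟨c, hc⟩ := h
  rw [← Finset.mem_coe, hc] at hu hvC
  obtain ⟨u, huc, rfl⟩ := hu
  by_contra! hle
  refine hvC ⟨⟨v, hv⟩, ?_, rfl⟩
  rw [SimpleGraph.ConnectedComponent.mem_supp_iff] at huc ⊢
  rw [← huc]
  refine (SimpleGraph.ConnectedComponent.sound ?_).symm
  exact reachable_of_perDist_le (f := fun u : {x // x ∈ X} => u.1) hle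

/-- Removing a cluster decreases the number of clusters by at most one. -/
theorem numClusters_le_of_isCluster {X C : Finset (box a b)} (h : IsCluster X C) :
    numClusters X ≤ clusterCount (fun u : ((X : Set (box a b)) \ C : Set (box a b)) => u.1) + 1 := by
  classical
  obtain ⟨c, hc⟩ := h
  let f : ((X : Set (box a b)) \ C : Set (box a b)) → box a b := fun u => u.1
  let φ : proximityGraph f →g graph X :=
    { toFun := fun u => ⟨u.1, u.2.1⟩
      map_rel' := fun {u v} huv => ⟨fun he => huv.1 (Subtype.ext (Subtype.mk.inj he)), huv.2⟩ }
  have : Finite ((X : Set (box a b)) \ C : Set (box a b)) := (X.finite_toSet.sdiff).to_subtype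
  have hfin : Finite (proximityGraph f).ConnectedComponent := Quot.finite _
  have hcard : Nat.card (Option (proximityGraph f).ConnectedComponent) = clusterCount f + 1 :=
    Finite.card_option
  rw [← hcard]
  -- `none` is sent to the removed component `c`; a component of the remaining points is sent to the
  -- one containing it in `X`.
  refine Nat.card_le_card_of_surjective
    (fun o => o.elim c fun e => e.map φ) fun e => ?_
  induction e using SimpleGraph.ConnectedComponent.ind with
  | h v =>
    by_cases hv : v.1 ∈ (C : Set (box a b))
    · refine ⟨none, ?_⟩
      rw [hc] at hv
      obtain ⟨w, hw, hwv⟩ := hv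
      rw [Subtype.ext hwv] at hw
      exact ((SimpleGraph.ConnectedComponent.mem_supp_iff _ _).1 hw).symm
    · exact ⟨some ((proximityGraph f).connectedComponentMk ⟨v.1, v.2, hv⟩), rfl⟩

theorem exists_isCompact_box_subset (a b : Fin d → ℝ) :
    ∃ K : Set (EuclideanSpace ℝ (Fin d)), IsCompact K ∧ box a b ⊆ K := by
  refine ⟨_, isCompact_Icc.image (s := Icc a b) (EuclideanSpace.equiv (Fin d) ℝ).symm.continuous,
    fun x hx => ⟨EuclideanSpace.equiv (Fin d) ℝ x, ?_, by simp⟩⟩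
  exact ⟨fun i => (hx i).1, fun i => (hx i).2.le⟩

/-- The number of separated sets of indices is bounded in terms of the box only. -/
theorem exists_card_isSeparated_le (a b : Fin d → ℝ) : ∃ M : ℕ, ∀ {ι : Type} [Fintype ι]
    (x : ι → box a b) (s : Finset (Finset ι)), (∀ I ∈ s, IsSeparated x (I : Set ι)) → s.card ≤ M := by
  classical
  obtain ⟨K, hK, hbK⟩ := exists_isCompact_box_subset a b
  obtain ⟨t, ht, hcov⟩ :=
    Metric.totallyBounded_iff.1 (hK.totallyBounded.subset hbK) (1 / 2) (by norm_num)
  have hex : ∀ u : box a b, ∃ y : t, dist u.1 y.1 < 1 / 2 := fun u => by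
    obtain ⟨y, hy, h⟩ := mem_iUnion₂.1 (hcov u.2)
    exact ⟨⟨y, hy⟩, h⟩
  choose p hp using hex
  have := ht.fintype
  refine ⟨Fintype.card (Finset t), fun {ι} _ x s hs => ?_⟩
  refine (Finset.card_le_card_of_injOn (fun I : Finset ι => I.image fun i => p (x i))
    (fun _ _ => Finset.mem_univ _) ?_).trans_eq Finset.card_univ
  -- Two points assigned to the same centre are at distance less than `1/2 + 1/2`, so a separated
  -- set containing one index contains the other. It is therefore determined by its set of centres.
  have key : ∀ I ∈ s, ∀ i, p (x i) ∈ I.image (fun i => p (x i)) → i ∈ I := fun I hI i hi => by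
    obtain ⟨j, hj, hji⟩ := Finset.mem_image.1 hi
    by_contra hiI
    refine absurd (hs I hI j hj i hiI) (not_lt.2 ((perDist_le_dist _ _).trans ?_))
    have h₁ := hp (x j)
    have h₂ := hp (x i)
    rw [hji] at h₁
    have := dist_triangle_right (x j : EuclideanSpace ℝ (Fin d)) (x i) (p (x i))
    rw [Subtype.dist_eq]
    linarith
  intro I hI J hJ hIJ
  replace hIJ : I.image (fun i => p (x i)) = J.image fun i => p (x i) := hIJ
  ext i
  constructor
  · exact fun hi => key J hJ i (hIJ ▸ Finset.mem_image_of_mem (fun i => p (x i)) hi)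
  · exact fun hi => key I hI i (hIJ.symm ▸ Finset.mem_image_of_mem (fun i => p (x i)) hi)

end Combinatorics

/-! ### Measurability of cluster counts and separation. -/

section Measurability

variable {ι Ω : Type*} [MeasurableSpace Ω]

theorem measurable_perDist {f g : Ω → box a b} (hf : Measurable f) (hg : Measurable g) :
    Measurable fun ω => perDist (f ω) (g ω) :=
  Measurable.iInf fun _ =>
    ((hf.subtype_val.sub hg.subtype_val).add_const _).norm

theorem measurable_one_lt_perDist {f g : Ω → box a b} (hf : Measurable f) (hg : Measurable g) :
    Measurable fun ω => 1 < perDist (f ω) (g ω) :=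
  measurableSet_setOfPred.1 (measurableSet_lt measurable_const (measurable_perDist hf hg))

theorem measurable_isSeparated [Countable ι] (A : Set ι) :
    Measurable fun x : ι → box a b => IsSeparated x A :=
  .forall fun i => .forall fun _ => .forall fun j => .forall fun _ =>
    measurable_one_lt_perDist (measurable_pi_apply i) (measurable_pi_apply j)

theorem measurable_isDisconnected [Finite ι] :
    Measurable fun x : ι → box a b => IsDisconnected x :=
  .exists fun A => .and measurable_const (.and measurable_const (measurable_isSeparated A))

/-- The count depends on `x` only through the proximity graph, which takes finitely many values,
each on a measurable set. -/
theorem measurable_clusterCount [Finite ι] :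
    Measurable fun x : ι → box a b => clusterCount x := by
  have hG : ∀ G : SimpleGraph ι, MeasurableSet {x : ι → box a b | proximityGraph x = G} := by
    intro G
    simp only [SimpleGraph.ext_iff, funext_iff, eq_iff_iff]
    refine Measurable.setOf (.forall fun i => .forall fun j => .iff ?_ measurable_const)
    exact .and measurable_const (measurableSet_setOfPred.1 (measurableSet_le
      (measurable_perDist (measurable_pi_apply i) (measurable_pi_apply j)) measurable_const))
  refine measurable_to_countable' fun n => ?_
  have : (fun x : ι → box a b => clusterCount x) ⁻¹' {n} =
      ⋃ G ∈ {G : SimpleGraph ι | Nat.card G.ConnectedComponent = n},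
        {x | proximityGraph x = G} := by
    ext x
    simp [clusterCount]
  rw [this]
  exact .biUnion (to_countable _) fun G _ => hG G

instance : MeasurableSingletonClass (box a b) := Subtype.instMeasurableSingletonClass

theorem measurable_apply_eq_apply (i j : ι) : Measurable fun x : ι → box a b => x i = x j :=
  measurableSet_setOfPred.1
    (measurableSet_eq_fun (measurable_pi_apply i) (measurable_pi_apply j))

theorem measurable_ncard_image [Finite ι] (I : Set ι) :
    Measurable fun x : ι → box a b => (x '' I).ncard := by
  refine measurable_to_countable' fun n => ?_
  -- `J` runs over the possible systems of representatives of the points carried by `I`.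
  have : (fun x : ι → box a b => (x '' I).ncard) ⁻¹' {n} =
      ⋃ J ∈ {J : Set ι | J ⊆ I ∧ J.ncard = n},
        {x | (∀ i ∈ J, ∀ j ∈ J, x i = x j → i = j) ∧ ∀ i ∈ I, ∃ j ∈ J, x j = x i} := by
    ext x
    simp only [mem_preimage, mem_singleton_iff, mem_iUnion, mem_ofPred_eq, exists_prop]
    constructor
    · intro h
      obtain ⟨J, hJI, hJ⟩ := exists_subset_bijOn I x
      refine ⟨J, ⟨hJI, ?_⟩, fun i hi j hj => hJ.injOn hi hj,
        fun i hi => hJ.surjOn (mem_image_of_mem x hi)⟩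
      rw [← h, ← hJ.image_eq, hJ.injOn.ncard_image]
    · rintro ⟨J, ⟨hJI, hn⟩, hinj, hsurj⟩
      have himage : x '' I = x '' J := by
        refine (image_subset_iff.2 fun i hi => ?_).antisymm (image_mono hJI)
        exact hsurj i hi
      have hinj' : InjOn x J := fun i hi j hj => hinj i hi j hj
      rw [himage, hinj'.ncard_image, hn]
  rw [this]
  refine .biUnion (to_countable _) fun J _ => Measurable.setOf (.and ?_ ?_)
  · exact .forall fun i => .forall fun _ => .forall fun j => .forall fun _ =>
      .imp (measurable_apply_eq_apply i j) measurable_const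
  · exact .forall fun i => .forall fun _ => .exists fun j => .and measurable_const
      (measurable_apply_eq_apply j i)

end Measurability

/-! ### Volumes of families and splitting of the free space. -/

section Volume

theorem measurableSet_box (a b : Fin d → ℝ) : MeasurableSet (box a b) := by
  simp only [box, ofPred_forall]
  exact .iInter fun i => measurableSet_Ico.preimage (by fun_prop)

theorem lebesgue_apply (S : Set (box a b)) : lebesgue a b S = volume (Subtype.val '' S) :=
  (MeasurableEmbedding.subtype_coe (measurableSet_box a b)).comap_apply _ _

instance isFiniteMeasure_lebesgue (a b : Fin d → ℝ) : IsFiniteMeasure (lebesgue a b) := by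
  obtain ⟨K, hK, hbK⟩ := exists_isCompact_box_subset a b
  refine ⟨?_⟩
  rw [lebesgue_apply]
  refine (measure_mono ?_).trans_lt hK.measure_lt_top
  simpa using hbK

theorem lebesgue_singleton (hd : d ≠ 0) (u : box a b) : lebesgue a b {u} = 0 := by
  have : Nonempty (Fin d) := ⟨⟨0, Nat.pos_of_ne_zero hd⟩⟩
  rw [lebesgue_apply, image_singleton, measure_singleton]

/-- Lebesgue measure on the families of points of the box. -/
abbrev lebesguePi (ι : Type*) [Fintype ι] (a b : Fin d → ℝ) : Measure (ι → box a b) :=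
  Measure.pi fun _ => lebesgue a b

/-- By Fubini each diagonal is null, because single points are. Almost surely a family of `n` points
is therefore a set of exactly `n` points. -/
theorem ae_injective (hd : d ≠ 0) (n : ℕ) :
    ∀ᵐ x ∂lebesguePi (Fin n) a b, Function.Injective x := by
  have key : ∀ i j : Fin n, i ≠ j → ∀ᵐ x ∂lebesguePi (Fin n) a b, x i ≠ x j := by
    intro i j hij
    obtain ⟨m, rfl⟩ : ∃ m, n = m + 1 := Nat.exists_eq_succ_of_ne_zero (by rintro rfl; exact i.elim0)
    obtain ⟨k, rfl⟩ := Fin.exists_succAbove_eq hij.symm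
    have hmp := measurePreserving_piFinSuccAbove (fun _ : Fin (m + 1) => lebesgue a b) i
    let s : Set (box a b × (Fin m → box a b)) := {p | p.1 = p.2 k}
    have hs : MeasurableSet s :=
      measurableSet_eq_fun measurable_fst ((measurable_pi_apply k).comp measurable_snd)
    have hs0 : (lebesgue a b).prod (lebesguePi (Fin m) a b) s = 0 := by
      rw [Measure.prod_apply_symm hs, lintegral_eq_zero_iff
        (measurable_measure_prodMk_right hs)]
      refine Filter.Eventually.of_forall fun y => ?_
      exact lebesgue_singleton hd (y k)
    rw [ae_iff, ← hmp.measure_preimage hs.nullMeasurableSet] at *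
    convert hs0 using 2
    ext x
    simp [s, MeasurableEquiv.piFinSuccAbove, Fin.insertNthEquiv, Fin.removeNth]
  have : ∀ᵐ x ∂lebesguePi (Fin n) a b, ∀ i j : Fin n, i ≠ j → x i ≠ x j := by
    simpa only [ae_all_iff] using key
  filter_upwards [this] with x hx i j hij
  by_contra h
  exact hx i j h hij

variable {ι κ : Type*} [Fintype ι] [Fintype κ]

/-- A measurable consequence of the existence of two far apart sets, each of which fills a
fraction `g` of the free volume. -/
def Splits (g : ℝ≥0∞) (Y : Set (box a b)) : Prop :=
  ∀ m : ℕ, 2 ≤ m → (g * lebesgue a b (freeOf Y)) ^ m ≤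
    lebesguePi (Fin m) a b {c | (∀ j, c j ∈ freeOf Y) ∧ IsDisconnected c}

theorem measurable_forall_mem_freeOf (κ : Type*) [Countable κ] :
    Measurable fun p : (ι → box a b) × (κ → box a b) => ∀ j, p.2 j ∈ freeOf (range p.1) := by
  simp only [freeOf, mem_ofPred_eq, forall_mem_range]
  exact .forall fun j => .forall fun i => measurable_one_lt_perDist
    ((measurable_pi_apply i).comp measurable_fst) ((measurable_pi_apply j).comp measurable_snd)

theorem measurable_lebesgue_freeOf :
    Measurable fun y : ι → box a b => lebesgue a b (freeOf (range y)) := by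
  refine measurable_measure_prodMk_left (ν := lebesgue a b)
    (s := {p : (ι → box a b) × box a b | p.2 ∈ freeOf (range p.1)}) ?_
  simp only [freeOf, mem_ofPred_eq, forall_mem_range]
  exact Measurable.setOf (.forall fun i => measurable_one_lt_perDist
    ((measurable_pi_apply i).comp measurable_fst) measurable_snd)

/-- Only countably many `m` occur, and both sides of each inequality are measures of sections of
measurable sets. The quantifier over pairs of Borel sets that `Splits` replaces would not be
amenable to this. -/
theorem measurable_splits (g : ℝ≥0∞) :
    Measurable fun y : ι → box a b => Splits g (range y) := by
  refine .forall fun m => .forall fun _ => measurableSet_setOfPred.1 (measurableSet_le ?_ ?_)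
  · exact (measurable_lebesgue_freeOf.const_mul g).pow_const m
  · refine measurable_measure_prodMk_left (ν := lebesguePi (Fin m) a b)
      (s := {p : (ι → box a b) × (Fin m → box a b) |
        (∀ j, p.2 j ∈ freeOf (range p.1)) ∧ IsDisconnected p.2}) ?_
    exact Measurable.setOf
      (.and (measurable_forall_mem_freeOf _) (measurable_isDisconnected.comp measurable_snd))

/-- The volume of the disconnected families in a set only depends on the number of indices. -/
theorem lebesguePi_isDisconnected_congr (e : κ ≃ ι) (D : Set (box a b)) :
    lebesguePi κ a b {c | (∀ j, c j ∈ D) ∧ IsDisconnected c} =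
      lebesguePi ι a b {c | (∀ j, c j ∈ D) ∧ IsDisconnected c} := by
  rw [← (measurePreserving_piCongrLeft (fun _ : ι => lebesgue a b) e).measure_preimage_equiv]
  congr 1
  ext c
  have hc : c = MeasurableEquiv.piCongrLeft (fun _ => box a b) e c ∘ e := by
    ext i
    simp [MeasurableEquiv.piCongrLeft, Equiv.piCongrLeft_apply_apply]
  simp only [mem_preimage, mem_ofPred_eq]
  conv_lhs => rw [hc]
  rw [isDisconnected_comp_equiv_iff]
  simp only [Function.comp_apply, e.forall_congr_left, Equiv.apply_symm_apply]

theorem Splits.pow_card_le {g : ℝ≥0∞} {Y : Set (box a b)} (h : Splits g Y)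
    (hι : 2 ≤ Fintype.card ι) :
    (g * lebesgue a b (freeOf Y)) ^ Fintype.card ι ≤
      lebesguePi ι a b {c | (∀ j, c j ∈ freeOf Y) ∧ IsDisconnected c} := by
  rw [← lebesguePi_isDisconnected_congr (Fintype.equivFin ι).symm]
  exact h _ hι

/-- The product set with one coordinate in `S` and all others in `T` consists of disconnected
families, as `m ≥ 2` makes both parts nonempty; each factor has volume at least `g |freeOf Y|`. -/
theorem splits_of_sets {g : ℝ≥0∞} {Y S T : Set (box a b)} (hS : S ⊆ freeOf Y) (hT : T ⊆ freeOf Y)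
    (hST : 1 < setDist S T) (hgS : g * lebesgue a b (freeOf Y) ≤ lebesgue a b S)
    (hgT : g * lebesgue a b (freeOf Y) ≤ lebesgue a b T) : Splits g Y := by
  have hdist : ∀ u ∈ S, ∀ v ∈ T, 1 < perDist u v := fun u hu v hv => by
    have h : setDist S T ≤ ENNReal.ofReal (perDist u v) := iInf₂_le_of_le u hu (iInf₂_le v hv)
    simpa using hST.trans_le h
  intro m hm
  let i₀ : Fin m := ⟨0, by omega⟩
  let i₁ : Fin m := ⟨1, by omega⟩
  have h01 : i₁ ≠ i₀ := by simp [i₀, i₁]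
  calc (g * lebesgue a b (freeOf Y)) ^ m
      = ∏ _i : Fin m, g * lebesgue a b (freeOf Y) := by simp
    _ ≤ ∏ i : Fin m, lebesgue a b (if i = i₀ then S else T) :=
        Finset.prod_le_prod' fun i _ => by split_ifs <;> assumption
    _ = lebesguePi (Fin m) a b (univ.pi fun i => if i = i₀ then S else T) :=
        (Measure.pi_pi _ _).symm
    _ ≤ _ := measure_mono fun c hc => ?_
  have h₀ : c i₀ ∈ S := by simpa using hc i₀ (mem_univ _)
  have hne : ∀ i ≠ i₀, c i ∈ T := fun i hi => by simpa [hi] using hc i (mem_univ _)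
  refine ⟨fun j => ?_, {i₀}, singleton_nonempty _, ⟨i₁, h01⟩, ?_⟩
  · by_cases hj : j = i₀
    · exact hS (hj ▸ h₀)
    · exact hT (hne j hj)
  · rintro _ rfl j hj
    exact hdist _ h₀ _ (hne j hj)

end Volume

/-! ### The resampling estimate for a fixed number of points. -/

section Estimate

variable {ι : Type*}

/-- The points with indices in `I` are separated from the others and form at most one cluster, and
the remaining points leave a free space that splits. -/
def IsRemovable (g : ℝ≥0∞) (x : ι → box a b) (I : Set ι) : Prop :=
  IsSeparated x I ∧ clusterCount x ≤ clusterCount (fun i : {i // i ∉ I} => x i) + 1 ∧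
    Splits g (range fun i : {i // i ∉ I} => x i)

/-- With the outer points fixed, separation constrains each inner point individually, so the
admissible inner families form a product set of volume `|D| ^ n`. -/
theorem isSeparated_iff {x : ι → box a b} {I : Set ι} :
    IsSeparated x I ↔ ∀ i : I, x i ∈ freeOf (range fun i : {i // i ∉ I} => x i) := by
  simp only [IsSeparated, freeOf, mem_ofPred_eq, forall_mem_range, Subtype.forall]
  exact forall₄_congr fun i _ j _ => by rw [perDist_comm]

variable [Fintype ι]

theorem measurable_isRemovable (g : ℝ≥0∞) (I : Set ι) :
    Measurable fun x : ι → box a b => IsRemovable g x I := by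
  classical
  have hr : Measurable fun (x : ι → box a b) (i : {i // i ∉ I}) => x i :=
    measurable_pi_lambda _ fun i => measurable_pi_apply _
  refine .and (measurable_isSeparated I) (.and (measurableSet_setOfPred.1 (measurableSet_le
    measurable_clusterCount ?_)) ((measurable_splits g).comp hr))
  exact (measurable_clusterCount.comp hr).add_const 1

theorem measurable_pow_clusterCount (Q : ℝ≥0∞) :
    Measurable fun x : ι → box a b => Q ^ clusterCount x :=
  (measurable_of_countable fun n : ℕ => Q ^ n).comp measurable_clusterCount

theorem lintegral_lebesguePi_eq (I : Set ι) [DecidablePred (· ∈ I)] {F : (ι → box a b) → ℝ≥0∞}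
    (hF : Measurable F) :
    ∫⁻ x, F x ∂lebesguePi ι a b = ∫⁻ y, ∫⁻ c,
      F ((MeasurableEquiv.piEquivPiSubtypeProd (fun _ => box a b) (· ∈ I)).symm (c, y))
        ∂lebesguePi {i // i ∈ I} a b ∂lebesguePi {i // i ∉ I} a b := by
  have hmp := measurePreserving_piEquivPiSubtypeProd (fun _ : ι => lebesgue a b) (· ∈ I)
  refine Eq.trans ?_ (lintegral_prod_symm' (fun p => F
    ((MeasurableEquiv.piEquivPiSubtypeProd (fun _ => box a b) (· ∈ I)).symm p))
    (hF.comp (MeasurableEquiv.measurable _)))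
  rw [hmp.lintegral_map_equiv]
  simp

/-- Resampling a removable part of the configuration creates an additional cluster at the cost of
a factor `g` for each resampled point. -/
theorem lintegral_isRemovable_le (I : Set ι) [DecidablePred (· ∈ I)]
    {n : ℕ} (hn : Fintype.card {i // i ∈ I} = n) (hn2 : 2 ≤ n) (g : ℝ≥0∞) {Q : ℝ≥0∞} (hQ : 1 ≤ Q) :
    g ^ n *
        (Q * ∫⁻ x in {x | IsRemovable g x I}, Q ^ clusterCount x ∂lebesguePi ι a b) ≤
      ∫⁻ x in {x | IsSeparated x I}, Q ^ clusterCount x ∂lebesguePi ι a b := by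
  have hm₁ : MeasurableSet {x : ι → box a b | IsRemovable g x I} :=
    (measurable_isRemovable g I).setOf
  have hm₂ : MeasurableSet {x : ι → box a b | IsSeparated x I} := (measurable_isSeparated I).setOf
  rw [← lintegral_indicator hm₁, ← lintegral_indicator hm₂,
    lintegral_lebesguePi_eq I ((measurable_pow_clusterCount Q).indicator hm₁),
    lintegral_lebesguePi_eq I ((measurable_pow_clusterCount Q).indicator hm₂)]
  -- Moving constants into an integral in this direction needs no measurability of the integrand.
  refine (mul_le_mul_right (lintegral_const_mul_le _ _) _).trans
    ((lintegral_const_mul_le _ _).trans (lintegral_mono fun y => ?_))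
  set e := MeasurableEquiv.piEquivPiSubtypeProd (fun _ : ι => box a b) (· ∈ I)
  set D := freeOf (range y)
  have hfst : ∀ c, (fun i : {i // i ∈ I} => e.symm (c, y) i) = c := fun c =>
    congrArg Prod.fst (e.apply_symm_apply (c, y))
  have hsnd : ∀ c, (fun i : {i // i ∉ I} => e.symm (c, y) i) = y := fun c =>
    congrArg Prod.snd (e.apply_symm_apply (c, y))
  have hsep : ∀ c, IsSeparated (e.symm (c, y)) I ↔ ∀ i, c i ∈ D := fun c => by
    rw [isSeparated_iff, hsnd]
    exact forall_congr' fun i => by rw [← congrFun (hfst c) i]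
  by_cases hy : Splits g (range y)
  -- Before resampling: at most one cluster beyond those of `y`, anywhere in the free space.
  · have hupper : ∀ c, indicator {x | IsRemovable g x I} (fun x => Q ^ clusterCount x)
        (e.symm (c, y)) ≤ indicator {c | ∀ i, c i ∈ D} (fun _ => Q ^ (clusterCount y + 1)) c := by
      intro c
      by_cases hc : IsRemovable g (e.symm (c, y)) I
      · have h₂ := hc.2.1
        rw [hsnd] at h₂
        rw [indicator_of_mem (show e.symm (c, y) ∈ {x | IsRemovable g x I} from hc),
          indicator_of_mem (show c ∈ {c | ∀ i, c i ∈ D} from (hsep c).1 hc.1)]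
        exact pow_le_pow_right₀ hQ h₂
      · rw [indicator_of_notMem (show e.symm (c, y) ∉ {x | IsRemovable g x I} from hc)]
        exact zero_le
    -- After resampling: a disconnected family in the free space adds at least two clusters to those
    -- of `y`.
    have hlower : ∀ c, indicator {c | (∀ i, c i ∈ D) ∧ IsDisconnected c}
        (fun _ => Q ^ (clusterCount y + 2)) c ≤
          indicator {x | IsSeparated x I} (fun x => Q ^ clusterCount x) (e.symm (c, y)) := by
      intro c
      by_cases hc : (∀ i, c i ∈ D) ∧ IsDisconnected c
      · have h₁ := (hsep c).2 hc.1
        have h₂ := clusterCount_add_two_le h₁ ((hfst c).symm ▸ hc.2)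
        rw [hsnd] at h₂
        rw [indicator_of_mem (show c ∈ {c | (∀ i, c i ∈ D) ∧ IsDisconnected c} from hc),
          indicator_of_mem (show e.symm (c, y) ∈ {x | IsSeparated x I} from h₁)]
        exact pow_le_pow_right₀ hQ h₂
      · rw [indicator_of_notMem (show c ∉ {c | (∀ i, c i ∈ D) ∧ IsDisconnected c} from hc)]
        exact zero_le
    have hmeas : MeasurableSet {c : {i // i ∈ I} → box a b | (∀ i, c i ∈ D) ∧ IsDisconnected c} :=
      Measurable.setOf (.and ((measurable_forall_mem_freeOf {i // i ∈ I}).comp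
        (measurable_const.prodMk measurable_id)) measurable_isDisconnected)
    have hvol : lebesguePi {i // i ∈ I} a b {c | ∀ i, c i ∈ D} =
        lebesgue a b D ^ n := by
      have : {c : {i // i ∈ I} → box a b | ∀ i, c i ∈ D} = univ.pi fun _ => D := by
        ext c
        simp
      rw [this, Measure.pi_pi, Finset.prod_const, Finset.card_univ, hn]
    calc _ ≤ g ^ n * (Q * (Q ^ (clusterCount y + 1) *
          lebesgue a b D ^ n)) := by
            gcongr
            rw [← hvol]
            exact (lintegral_mono hupper).trans (lintegral_indicator_const_le _ _)
      _ = Q ^ (clusterCount y + 2) * (g * lebesgue a b D) ^ n := by ring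
      _ ≤ Q ^ (clusterCount y + 2) *
          lebesguePi {i // i ∈ I} a b {c | (∀ i, c i ∈ D) ∧ IsDisconnected c} := by
            gcongr
            exact hn ▸ hy.pow_card_le (hn ▸ hn2)
      _ ≤ _ := by
            rw [← lintegral_indicator_const hmeas]
            exact lintegral_mono hlower
  · have : ∀ c, indicator {x | IsRemovable g x I} (fun x => Q ^ clusterCount x)
        (e.symm (c, y)) = 0 := fun c => by
      refine indicator_of_notMem (fun h => hy ?_) _
      have := h.2.2
      rwa [hsnd] at this
    simp [this]

/-- Families with a removable part of less than `N₀` points have a weight that is small compared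
to the total weight. -/
theorem lintegral_exists_isRemovable_le {M N₀ : ℕ}
    (hM : ∀ (x : ι → box a b) (s : Finset (Finset ι)),
      (∀ I ∈ s, IsSeparated x (I : Set ι)) → s.card ≤ M)
    {g Q : ℝ≥0∞} (hg : g ≤ 1) (hQ : 1 ≤ Q) :
    g ^ N₀ * (Q * ∫⁻ x in {x | ∃ I : Finset ι, (2 ≤ I.card ∧ I.card < N₀) ∧
        IsRemovable g x (I : Set ι)}, Q ^ clusterCount x ∂lebesguePi ι a b) ≤
      M * ∫⁻ x, Q ^ clusterCount x ∂lebesguePi ι a b := by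
  classical
  have hm₂ : ∀ I : Finset ι, MeasurableSet {x : ι → box a b | IsSeparated x (I : Set ι)} :=
    fun I => (measurable_isSeparated _).setOf
  have hterm : ∀ I : Finset ι, g ^ N₀ * (Q * ∫⁻ x in {x | (2 ≤ I.card ∧ I.card < N₀) ∧
      IsRemovable g x (I : Set ι)}, Q ^ clusterCount x ∂lebesguePi ι a b) ≤
        ∫⁻ x in {x | IsSeparated x (I : Set ι)}, Q ^ clusterCount x ∂lebesguePi ι a b := by
    intro I
    by_cases hI : 2 ≤ I.card ∧ I.card < N₀
    · have := lintegral_isRemovable_le (a := a) (b := b) (I : Set ι) (n := I.card) (by simp)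
        hI.1 g hQ
      simp only [hI, true_and, and_self]
      refine le_trans ?_ this
      gcongr ?_ * _
      -- Since `g ≤ 1`, the factor `g ^ N₀` serves all sizes below `N₀` at once.
      exact pow_le_pow_of_le_one zero_le hg hI.2.le
    · simp [hI]
  calc _ ≤ g ^ N₀ * (Q * ∑ I : Finset ι, ∫⁻ x in {x | (2 ≤ I.card ∧ I.card < N₀) ∧
          IsRemovable g x (I : Set ι)}, Q ^ clusterCount x ∂lebesguePi ι a b) := by
        gcongr
        rw [ofPred_exists]
        exact (lintegral_iUnion_le _ _).trans_eq (tsum_fintype _)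
    _ = ∑ I : Finset ι, g ^ N₀ * (Q * ∫⁻ x in {x | (2 ≤ I.card ∧ I.card < N₀) ∧
          IsRemovable g x (I : Set ι)}, Q ^ clusterCount x ∂lebesguePi ι a b) := by
        rw [Finset.mul_sum, Finset.mul_sum]
    _ ≤ ∑ I : Finset ι, ∫⁻ x in {x | IsSeparated x (I : Set ι)}, Q ^ clusterCount x
          ∂lebesguePi ι a b := Finset.sum_le_sum fun I _ => hterm I
    _ = ∫⁻ x, ∑ I : Finset ι, indicator {x | IsSeparated x (I : Set ι)}
          (fun x => Q ^ clusterCount x) x ∂lebesguePi ι a b := by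
        rw [lintegral_finsetSum _ fun I _ => (measurable_pow_clusterCount Q).indicator (hm₂ I)]
        exact Finset.sum_congr rfl fun I _ => (lintegral_indicator (hm₂ I) _).symm
    _ ≤ ∫⁻ x, M * Q ^ clusterCount x ∂lebesguePi ι a b := by
        -- At each `x` the indicators count its separated sets, of which there are at most `M`.
        refine lintegral_mono fun x => ?_
        simp only [indicator_apply, mem_ofPred_eq]
        rw [← Finset.sum_filter, Finset.sum_const, nsmul_eq_mul]
        gcongr
        exact hM x _ fun I hI => (Finset.mem_filter.1 hI).2
    _ = _ := lintegral_const_mul _ (measurable_pow_clusterCount Q)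

end Estimate

/-! ### From families of points to the random-cluster measure. -/

section Config

theorem measurableSet_config_iff {A : Set (Config a b)} :
    MeasurableSet A ↔ ∀ n, MeasurableSet (ofTuple n ⁻¹' A) := by
  simp only [MeasurableSpace.measurableSet_iInf]
  rfl

theorem measurable_config_iff {β : Type*} [MeasurableSpace β] {f : Config a b → β} :
    Measurable f ↔ ∀ n, Measurable fun x => f (ofTuple n x) := by
  refine ⟨fun hf n s hs => measurableSet_config_iff.1 (hf hs) n,
    fun hf s hs => measurableSet_config_iff.2 fun n => hf n hs⟩

theorem measurable_ofTuple (n : ℕ) : Measurable (ofTuple n : (Fin n → box a b) → Config a b) :=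
  measurable_config_iff.1 measurable_id n

theorem coe_points_ofTuple {n : ℕ} (x : Fin n → box a b) :
    ((ofTuple n x).points : Set (box a b)) = range x := by
  simp [ofTuple]

theorem card_points_ofTuple {n : ℕ} (x : Fin n → box a b) :
    (ofTuple n x).points.card = (x '' univ).ncard := by
  rw [← ncard_coe_finset, coe_points_ofTuple, image_univ]

theorem numClusters_ofTuple {n : ℕ} (x : Fin n → box a b) :
    numClusters (ofTuple n x).points = clusterCount x := by
  refine clusterCount_eq_of_range_eq (f := fun u : {u // u ∈ (ofTuple n x).points} => u.1) ?_
  rw [← coe_points_ofTuple x]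
  exact Subtype.range_val

theorem measurable_weight (q z : ℝ) : Measurable (weight q z : Config a b → ℝ≥0∞) := by
  refine measurable_config_iff.2 fun n => ?_
  simp only [weight, card_points_ofTuple, numClusters_ofTuple]
  exact (((measurable_of_countable fun k : ℕ => z ^ k).comp (measurable_ncard_image univ)).mul
    ((measurable_of_countable fun k : ℕ => q ^ k).comp measurable_clusterCount)).ennreal_ofReal

theorem weight_ofTuple {n : ℕ} {x : Fin n → box a b} (hx : Function.Injective x) {q z : ℝ}
    (hq : 0 ≤ q) (hz : 0 ≤ z) :
    weight q z (ofTuple n x) = ENNReal.ofReal z ^ n * ENNReal.ofReal q ^ clusterCount x := by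
  rw [weight, numClusters_ofTuple, card_points_ofTuple, hx.injOn.ncard_image, ncard_univ,
    Nat.card_fin, ENNReal.ofReal_mul (by positivity), ENNReal.ofReal_pow hz, ENNReal.ofReal_pow hq]

theorem setLIntegral_lebesguePoisson {f : Config a b → ℝ≥0∞} (hf : Measurable f)
    {A : Set (Config a b)} (hA : MeasurableSet A) :
    ∫⁻ X in A, f X ∂lebesguePoisson a b = ∑' n : ℕ, (n.factorial : ℝ≥0∞)⁻¹ *
      ∫⁻ x in ofTuple n ⁻¹' A, f (ofTuple n x) ∂lebesguePi (Fin n) a b := by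
  rw [lebesguePoisson, Measure.restrict_sum _ hA, lintegral_sum_measure]
  refine tsum_congr fun n => ?_
  rw [setLIntegral_smul_measure, setLIntegral_map hA hf (measurable_ofTuple n), smul_eq_mul]

theorem partitionFunction_eq (a b : Fin d → ℝ) (q z : ℝ) :
    partitionFunction a b q z = ∑' n : ℕ, (n.factorial : ℝ≥0∞)⁻¹ *
      ∫⁻ x, weight q z (ofTuple n x) ∂lebesguePi (Fin n) a b := by
  have := setLIntegral_lebesguePoisson (measurable_weight q z) (MeasurableSet.univ (α := Config a b))
  simpa only [partitionFunction, preimage_univ, Measure.restrict_univ] using this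

theorem partitionFunction_ne_zero (a b : Fin d → ℝ) (q z : ℝ) :
    partitionFunction a b q z ≠ 0 := by
  have hw : ∀ x : Fin 0 → box a b, weight q z (ofTuple 0 x) = 1 := fun x => by
    have h0 : clusterCount x = 0 := Nat.le_zero.1 ((clusterCount_le_card x).trans_eq (by simp))
    rw [weight, numClusters_ofTuple, card_points_ofTuple, h0]
    simp
  rw [partitionFunction_eq]
  refine (lt_of_lt_of_le ?_ (ENNReal.le_tsum 0)).ne'
  simp [hw]

/-- There are at most `n` clusters, so the `n`-point term is at most `(z q |Λ|) ^ n / n!`, a term of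
the exponential series. -/
theorem partitionFunction_ne_top (hd : d ≠ 0) (a b : Fin d → ℝ) {q z : ℝ} (hq : 1 ≤ q)
    (hz : 0 ≤ z) : partitionFunction a b q z ≠ ∞ := by
  set t : ℝ := z * q * (lebesgue a b).real univ
  have ht : 0 ≤ t := by positivity
  have hQ : 1 ≤ ENNReal.ofReal q := ENNReal.one_le_ofReal.2 hq
  have hterm : ∀ n : ℕ, (n.factorial : ℝ≥0∞)⁻¹ *
      ∫⁻ x, weight q z (ofTuple n x) ∂lebesguePi (Fin n) a b ≤
        ENNReal.ofReal (t ^ n / n.factorial) := fun n => by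
    have hint : ∫⁻ x, weight q z (ofTuple n x) ∂lebesguePi (Fin n) a b ≤ ENNReal.ofReal t ^ n := by
      calc _ ≤ ∫⁻ _x, (ENNReal.ofReal z * ENNReal.ofReal q) ^ n ∂lebesguePi (Fin n) a b := by
            refine lintegral_mono_ae ?_
            filter_upwards [ae_injective hd n] with x hx
            rw [weight_ofTuple hx (by positivity) hz, mul_pow]
            gcongr
            exact (clusterCount_le_card x).trans_eq (by simp)
        _ = _ := by
            rw [lintegral_const, Measure.pi_univ, Finset.prod_const, Finset.card_univ,
              Fintype.card_fin, ← mul_pow, ENNReal.ofReal_mul (by positivity),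
              ENNReal.ofReal_mul hz, ofReal_measureReal]
    rw [ENNReal.ofReal_div_of_pos (by positivity), ENNReal.ofReal_natCast, ENNReal.ofReal_pow ht,
      ENNReal.div_eq_inv_mul]
    gcongr
  rw [partitionFunction_eq]
  refine ne_top_of_le_ne_top ?_ (ENNReal.tsum_le_tsum hterm)
  rw [← ENNReal.ofReal_tsum_of_nonneg (fun n => by positivity)
    (Real.summable_pow_div_factorial t)]
  exact ENNReal.ofReal_ne_top

theorem isProbabilityMeasure_randomCluster (hd : d ≠ 0) (a b : Fin d → ℝ) {q z : ℝ} (hq : 1 ≤ q)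
    (hz : 0 ≤ z) : IsProbabilityMeasure (randomCluster a b q z) := by
  refine ⟨?_⟩
  rw [randomCluster, Measure.smul_apply, withDensity_apply _ MeasurableSet.univ,
    Measure.restrict_univ, smul_eq_mul]
  exact ENNReal.inv_mul_cancel (partitionFunction_ne_zero a b q z)
    (partitionFunction_ne_top hd a b hq hz)

/-- Configurations with a removable set of at least two and less than `N₀` points. -/
def exceptional (a b : Fin d → ℝ) (g : ℝ≥0∞) (N₀ : ℕ) : Set (Config a b) :=
  {X | ∃ C ⊆ X.points, (2 ≤ C.card ∧ C.card < N₀) ∧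
    IsRemovable g (fun u : {u // u ∈ X.points} => u.1) {u | u.1 ∈ C}}

/-- A cluster that is neither a singleton nor confined is removable: it is separated, its removal
costs at most one cluster, and its two far apart sets make the free space split. -/
theorem compl_subset_exceptional (a b : Fin d → ℝ) (γ : ℝ) (N₀ : ℕ) :
    (disordered a b γ ∪ ordered a b N₀)ᶜ ⊆ exceptional a b (ENNReal.ofReal (γ / 2)) N₀ := by
  intro X hX
  simp only [mem_compl_iff, mem_union, not_or, disordered, ordered, mem_ofPred_eq, not_forall,
    not_exists, not_and, not_le, not_or] at hX
  obtain ⟨⟨C, hC, hnot⟩, hord⟩ := hX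
  have hpos := (isCluster_nonempty hC).card_pos
  have h2 : 2 ≤ C.card := by
    have := hnot.1
    omega
  have hrange : (range fun i : {i : {u // u ∈ X.points} // i ∉ {u | u.1 ∈ C}} => i.1.1) =
      (X.points : Set (box a b)) \ C := by
    ext u
    simp [and_comm]
  have hsplit : ∃ S T : Set (box a b), MeasurableSet S ∧ MeasurableSet T ∧
      S ⊆ freeSpace X.points C ∧ T ⊆ freeSpace X.points C ∧ 1 < setDist S T ∧
      ENNReal.ofReal (γ / 2) * lebesgue a b (freeSpace X.points C) ≤ lebesgue a b S ∧
      ENNReal.ofReal (γ / 2) * lebesgue a b (freeSpace X.points C) ≤ lebesgue a b T := by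
    by_contra h
    exact hnot.2 ⟨h2, h⟩
  obtain ⟨S, T, -, -, hS, hT, hST, hgS, hgT⟩ := hsplit
  rw [freeSpace_eq_freeOf] at hS hT hgS hgT
  refine ⟨C, isCluster_subset hC, ⟨h2, hord C hC⟩, ?_, ?_, ?_⟩
  · exact fun u hu v hv => isCluster_one_lt_perDist hC hu v.2 hv
  · refine (numClusters_le_of_isCluster hC).trans_eq ?_
    have : Finite ((X.points : Set (box a b)) \ C : Set (box a b)) :=
      (X.points.finite_toSet.sdiff).to_subtype
    rw [clusterCount_eq_of_range_eq (Subtype.range_val.trans hrange.symm)]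
  · rw [hrange]
    exact splits_of_sets hS hT hST hgS hgT

theorem ofTuple_mem_exceptional_iff {g : ℝ≥0∞} {N₀ n : ℕ} {x : Fin n → box a b} :
    ofTuple n x ∈ exceptional a b g N₀ ↔ ∃ I : Finset (Fin n),
      (2 ≤ (x '' I).ncard ∧ (x '' I).ncard < N₀) ∧ IsRemovable g x (I : Set (Fin n)) := by
  classical
  have hmem : ∀ u, u ∈ (ofTuple n x).points ↔ ∃ i, x i = u := fun u => by
    rw [← Finset.mem_coe, coe_points_ofTuple, mem_range]
  have hx : ∀ i, x i ∈ (ofTuple n x).points := fun i => (hmem _).2 ⟨i, rfl⟩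
  have key : ∀ (C : Finset (box a b)) (I : Finset (Fin n)), (∀ i, i ∈ I ↔ x i ∈ C) →
      (IsRemovable g (fun u : {u // u ∈ (ofTuple n x).points} => u.1) {u | u.1 ∈ C} ↔
        IsRemovable g x (I : Set (Fin n))) := by
    intro C I hI
    have hrange : (range fun i : {i : {u // u ∈ (ofTuple n x).points} // i ∉ {u | u.1 ∈ C}} =>
        i.1.1) = range fun i : {i // i ∉ (I : Set (Fin n))} => x i := by
      ext u
      constructor
      · rintro ⟨⟨⟨v, hv⟩, hvC⟩, rfl⟩
        obtain ⟨i, rfl⟩ := (hmem v).1 hv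
        exact ⟨⟨i, fun hi => hvC ((hI i).1 hi)⟩, rfl⟩
      · rintro ⟨⟨i, hi⟩, rfl⟩
        exact ⟨⟨⟨x i, hx i⟩, fun hC => hi ((hI i).2 hC)⟩, rfl⟩
    refine and_congr ?_ (and_congr ?_ (by rw [hrange]))
    · constructor
      · exact fun h i hi j hj => h ⟨x i, hx i⟩ ((hI i).1 hi) ⟨x j, hx j⟩ fun hC => hj ((hI j).2 hC)
      · rintro h ⟨u, hu⟩ huC ⟨v, hv⟩ hvC
        obtain ⟨i, rfl⟩ := (hmem u).1 hu
        obtain ⟨j, rfl⟩ := (hmem v).1 hv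
        exact h i ((hI i).2 huC) j fun hj => hvC ((hI j).1 hj)
    · rw [clusterCount_eq_of_range_eq hrange, ← numClusters_ofTuple x]
      rfl
  constructor
  · rintro ⟨C, hCX, hcard, hrem⟩
    let I : Finset (Fin n) := Finset.univ.filter fun i => x i ∈ C
    have hI : ∀ i, i ∈ I ↔ x i ∈ C := fun i => by simp [I]
    have himage : x '' I = C := by
      ext u
      constructor
      · rintro ⟨i, hi, rfl⟩
        exact (hI i).1 hi
      · intro hu
        obtain ⟨i, rfl⟩ := (hmem u).1 (hCX hu)
        exact ⟨i, (hI i).2 hu, rfl⟩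
    refine ⟨I, ?_, (key C I hI).1 hrem⟩
    rwa [himage, ncard_coe_finset]
  · rintro ⟨I, hcard, hrem⟩
    -- A separated `I` contains every index carrying one of its points, since equal points have
    -- distance `0`.
    have hI : ∀ i, i ∈ I ↔ x i ∈ I.image x := fun i => by
      refine ⟨Finset.mem_image_of_mem x, fun h => ?_⟩
      obtain ⟨j, hj, hji⟩ := Finset.mem_image.1 h
      by_contra hi
      have := hrem.1 j hj i hi
      rw [hji, perDist_self] at this
      linarith
    refine ⟨I.image x, fun u hu => ?_, ?_, (key _ I hI).2 hrem⟩
    · obtain ⟨i, -, rfl⟩ := Finset.mem_image.1 hu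
      exact hx i
    · rwa [← Finset.coe_image, ncard_coe_finset] at hcard

theorem measurableSet_exceptional (a b : Fin d → ℝ) (g : ℝ≥0∞) (N₀ : ℕ) :
    MeasurableSet (exceptional a b g N₀) := by
  refine measurableSet_config_iff.2 fun n => ?_
  simp only [preimage, ofTuple_mem_exceptional_iff]
  refine Measurable.setOf (.exists fun I => .and ?_ (measurable_isRemovable g _))
  exact ((measurable_of_countable fun k : ℕ => 2 ≤ k ∧ k < N₀).comp (measurable_ncard_image _))

/-- Almost everywhere the weight is `z ^ n` times a power of `q`, and `z ^ n` factors out of both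
sides; hence the bound is uniform in `z`. -/
theorem setLIntegral_exceptional_le (hd : d ≠ 0) {M N₀ n : ℕ}
    (hM : ∀ (x : Fin n → box a b) (s : Finset (Finset (Fin n))),
      (∀ I ∈ s, IsSeparated x (I : Set (Fin n))) → s.card ≤ M)
    {g : ℝ≥0∞} (hg : g ≤ 1) {q z : ℝ} (hq : 1 ≤ q) (hz : 0 ≤ z) :
    g ^ N₀ * ENNReal.ofReal q * ∫⁻ x in ofTuple n ⁻¹' exceptional a b g N₀,
        weight q z (ofTuple n x) ∂lebesguePi (Fin n) a b ≤
      M * ∫⁻ x, weight q z (ofTuple n x) ∂lebesguePi (Fin n) a b := by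
  set Q := ENNReal.ofReal q
  have hQ : 1 ≤ Q := ENNReal.one_le_ofReal.2 hq
  have hw : (fun x => weight q z (ofTuple n x)) =ᵐ[lebesguePi (Fin n) a b]
      fun x => ENNReal.ofReal z ^ n * Q ^ clusterCount x := by
    filter_upwards [ae_injective hd n] with x hx
    exact weight_ofTuple hx (by positivity) hz
  have hset : ofTuple n ⁻¹' exceptional a b g N₀ ≤ᵐ[lebesguePi (Fin n) a b]
      {x | ∃ I : Finset (Fin n), (2 ≤ I.card ∧ I.card < N₀) ∧
        IsRemovable g x (I : Set (Fin n))} := by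
    filter_upwards [ae_injective hd n] with x hx hmem
    obtain ⟨I, hI, hrem⟩ := ofTuple_mem_exceptional_iff.1 hmem
    rw [hx.injOn.ncard_image, ncard_coe_finset] at hI
    exact ⟨I, hI, hrem⟩
  rw [lintegral_congr_ae hw, lintegral_congr_ae (ae_restrict_of_ae hw),
    lintegral_const_mul _ (measurable_pow_clusterCount Q),
    lintegral_const_mul _ (measurable_pow_clusterCount Q)]
  calc _ ≤ g ^ N₀ * Q * (ENNReal.ofReal z ^ n * ∫⁻ x in {x | ∃ I : Finset (Fin n),
          (2 ≤ I.card ∧ I.card < N₀) ∧ IsRemovable g x (I : Set (Fin n))},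
            Q ^ clusterCount x ∂lebesguePi (Fin n) a b) := by
        refine mul_le_mul_right (mul_le_mul_right ?_ _) _
        exact lintegral_mono' (Measure.restrict_mono_ae hset) le_rfl
    _ = ENNReal.ofReal z ^ n * (g ^ N₀ * (Q * ∫⁻ x in {x | ∃ I : Finset (Fin n),
          (2 ≤ I.card ∧ I.card < N₀) ∧ IsRemovable g x (I : Set (Fin n))},
            Q ^ clusterCount x ∂lebesguePi (Fin n) a b)) := by ring
    _ ≤ ENNReal.ofReal z ^ n * (M * ∫⁻ x, Q ^ clusterCount x ∂lebesguePi (Fin n) a b) := by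
        exact mul_le_mul_right (lintegral_exists_isRemovable_le hM hg hQ) _
    _ = _ := by ring

theorem randomCluster_exceptional_le (hd : d ≠ 0) {M N₀ : ℕ}
    (hM : ∀ (n : ℕ) (x : Fin n → box a b) (s : Finset (Finset (Fin n))),
      (∀ I ∈ s, IsSeparated x (I : Set (Fin n))) → s.card ≤ M)
    {g : ℝ≥0∞} (hg : g ≤ 1) {q z : ℝ} (hq : 1 ≤ q) (hz : 0 ≤ z) :
    g ^ N₀ * ENNReal.ofReal q * randomCluster a b q z (exceptional a b g N₀) ≤ M := by
  have hexc := measurableSet_exceptional a b g N₀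
  have hle : g ^ N₀ * ENNReal.ofReal q *
      ∫⁻ X in exceptional a b g N₀, weight q z X ∂lebesguePoisson a b ≤
        M * partitionFunction a b q z := by
    rw [setLIntegral_lebesguePoisson (measurable_weight q z) hexc, partitionFunction_eq,
      ← ENNReal.tsum_mul_left, ← ENNReal.tsum_mul_left]
    refine ENNReal.tsum_le_tsum fun n => ?_
    rw [mul_left_comm, mul_left_comm (M : ℝ≥0∞)]
    exact mul_le_mul_right (setLIntegral_exceptional_le hd (hM n) hg hq hz) _
  rw [randomCluster, Measure.smul_apply, withDensity_apply _ hexc, smul_eq_mul, mul_left_comm,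
    mul_comm, ← div_eq_mul_inv]
  exact ENNReal.div_le_of_le_mul hle

end Config

end WidomRowlinson

end

/-! ### Choice of `q₀` and conclusion. -/

theorem mainTheorem2 (d : ℕ) (hd : 2 ≤ d) (a b : Fin d → ℝ) (hab : ∀ i, a i < b i)
    (γ : ℝ) (hγ0 : 0 < γ) (hγ1 : γ < 1) (N₀ : ℕ) (ε : ℝ) (hε : 0 < ε) :
    ∃ q₀ : ℝ, 1 ≤ q₀ ∧ ∀ q : ℝ, q₀ ≤ q → ∀ z : ℝ, 0 < z →
      MeasureTheory.IsProbabilityMeasure (WidomRowlinson.randomCluster a b q z) ∧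
      ENNReal.ofReal (1 - ε) ≤ WidomRowlinson.randomCluster a b q z
        (WidomRowlinson.disordered a b γ ∪ WidomRowlinson.ordered a b N₀) ∧
      WidomRowlinson.randomCluster a b q z
        (WidomRowlinson.disordered a b γ ∪ WidomRowlinson.ordered a b N₀)ᶜ ≤
          ENNReal.ofReal ε := by
  have hd0 : d ≠ 0 := by omega
  obtain ⟨M, hM⟩ := WidomRowlinson.exists_card_isSeparated_le a b
  set g := ENNReal.ofReal (γ / 2) with hgdef
  have hg1 : g ≤ 1 := ENNReal.ofReal_le_one.2 (by linarith)
  -- The second term is chosen so that `M / (q (γ / 2) ^ N₀) ≤ ε` for `q ≥ q₀`.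
  refine ⟨max 1 (M / ((γ / 2) ^ N₀ * ε)), le_max_left _ _, fun q hq z hz => ?_⟩
  have hq1 : 1 ≤ q := (le_max_left _ _).trans hq
  have hprob := WidomRowlinson.isProbabilityMeasure_randomCluster hd0 a b hq1 hz.le
  have hbound : WidomRowlinson.randomCluster a b q z
      (WidomRowlinson.disordered a b γ ∪ WidomRowlinson.ordered a b N₀)ᶜ ≤ ENNReal.ofReal ε := by
    refine (measure_mono (WidomRowlinson.compl_subset_exceptional a b γ N₀)).trans ?_
    have hexc := WidomRowlinson.randomCluster_exceptional_le (N₀ := N₀) hd0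
      (fun n => hM (ι := Fin n)) hg1 hq1 hz.le
    have hMq : (M : ℝ≥0∞) ≤ g ^ N₀ * ENNReal.ofReal q * ENNReal.ofReal ε := by
      have h : M ≤ q * ((γ / 2) ^ N₀ * ε) :=
        (div_le_iff₀ (by positivity)).1 ((le_max_right _ _).trans hq)
      rw [hgdef, ← ENNReal.ofReal_pow (by positivity), ← ENNReal.ofReal_mul (by positivity),
        ← ENNReal.ofReal_mul (by positivity), ← ENNReal.ofReal_natCast]
      exact ENNReal.ofReal_le_ofReal (h.trans_eq (by ring))
    have hpos : g ^ N₀ * ENNReal.ofReal q ≠ 0 :=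
      mul_ne_zero (pow_ne_zero _ (ENNReal.ofReal_pos.2 (by linarith)).ne')
        (ENNReal.ofReal_pos.2 (by linarith)).ne'
    have htop : g ^ N₀ * ENNReal.ofReal q ≠ ∞ :=
      ENNReal.mul_ne_top (ENNReal.pow_ne_top ENNReal.ofReal_ne_top) ENNReal.ofReal_ne_top
    exact (ENNReal.mul_le_mul_iff_right hpos htop).1 (hexc.trans hMq)
  refine ⟨hprob, ?_, hbound⟩
  -- Subadditivity gives the lower bound without measurability of the two events.
  have huniv := measure_union_le (μ := WidomRowlinson.randomCluster a b q z)
    (WidomRowlinson.disordered a b γ ∪ WidomRowlinson.ordered a b N₀)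
    (WidomRowlinson.disordered a b γ ∪ WidomRowlinson.ordered a b N₀)ᶜ
  rw [union_compl_self, measure_univ] at huniv
  rw [ENNReal.ofReal_sub _ hε.le, ENNReal.ofReal_one]
  exact tsub_le_iff_right.2 (huniv.trans (by gcongr))
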